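/- Let $n\ge 1$ be an integer, $1<p<\infty$, $\frac1p+\frac1{p'}=1$, and let $g\in\mathcal S(\mathbb R^n)$ be a (complex-valued) Schwartz function. For $s\ge 0$ let $(-\Delta)^{s/2}g$ be the function on $\mathbb R^n$ defined by $$(-\Delta)^{s/2}g(x)=\int_{\mathbb R^n}(2\pi|\xi|)^{s}\,\hat g(\xi)\,e^{2\pi i x\cdot\xi}\,d\xi,\qquad \hat g(\xi)=\int_{\mathbb R^n}g(x)\,e^{-2\pi i x\cdot\xi}\,dx .$$ (i) (Pitt's inequality in $L^p$ as a weighted Sobolev inequality.) For every real $\alpha$ with $0\le\alpha<n$, $$\big\|\,|x|^{-\alpha/p}g\big\|_{L^p(\mathbb R^n)}\le 2^{-\alpha/p}\left[\frac{\Gamma\big(\frac{n-\alpha}{2p}\big)\,\Gamma\big(\frac{n}{2p'}\big)}{\Gamma\big(\frac{n}{2p'}+\frac{\alpha}{2p}\big)\,\Gamma\big(\frac{n}{2p}\big)}\right]\big\|(-\Delta)^{\alpha/(2p)}g\big\|_{L^p(\mathbb R^n)} .$$ (ii) (Classical Hardy--Rellich inequality.) If $1<p<n/2$, then $$\int_{\mathbb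 R^n}|x|^{-2p}|g|^p\,dx\le\left[\frac{p\,p'}{n(n-2p)}\right]^p\int_{\mathbb R^n}|\Delta g|^p\,dx .$$ -/

import Mathlib

open MeasureTheory
open scoped SchwartzMap FourierTransform Laplacian

/-- The fractional power `(-Δ)^{s/2} g` of the Laplacian on `ℝⁿ`, for `s ≥ 0` and a Schwartz
function `g`: the Fourier multiplier operator with symbol `(2π|ξ|)^s`,
`(-Δ)^{s/2} g (x) = ∫ (2π|ξ|)^s ĝ(ξ) e^{2πi⟨x, ξ⟩} dξ`, where `ĝ(ξ) = ∫ g(x) e^{-2πi⟨x, ξ⟩} dx`.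
(The integrand is integrable for every `s ≥ 0`; the symbol for `s = 0` is `1`.) -/
noncomputable def fracLaplacian {n : ℕ} (s : ℝ) (g : 𝓢(EuclideanSpace ℝ (Fin n), ℂ)) :
    EuclideanSpace ℝ (Fin n) → ℂ :=
  𝓕⁻ (fun ξ : EuclideanSpace ℝ (Fin n) =>
    (((2 * Real.pi * ‖ξ‖) ^ s : ℝ) : ℂ) * 𝓕 (g : EuclideanSpace ℝ (Fin n) → ℂ) ξ)

/-- The constant
`2^{-α/p} Γ((n-α)/(2p)) Γ(n/(2p')) / (Γ(n/(2p') + α/(2p)) Γ(n/(2p)))`, where `q` stands for the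
conjugate exponent `p'`. -/
noncomputable def pittConst (n : ℕ) (p q α : ℝ) : ℝ :=
  (2 : ℝ) ^ (-(α / p)) *
    ((Real.Gamma (((n : ℝ) - α) / (2 * p)) * Real.Gamma ((n : ℝ) / (2 * q))) /
      (Real.Gamma ((n : ℝ) / (2 * q) + α / (2 * p)) * Real.Gamma ((n : ℝ) / (2 * p))))

/-!
Set `s = α / p` and `f = (-Δ)^(s/2) g`. Then `g` is the Riesz potential `R_s * f`, so the inequality
says that the integral operator with kernel `‖x‖^(-s) R_s(x - y)` is bounded on `L^p` with norm at
most the stated constant. The kernel is positive and homogeneous of degree `-n`, hence Schur's test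
with powers of the norm applies: both of its conditions are instances of the Riesz composition
formula `R_a * R_b = R_(a+b)`, where `R_b` is an explicit multiple of `‖x‖^(b-n)`, and both give the
same constant, the quotient of two normalising factors, which is the quotient of Gamma functions in
`pittConst`.

Everything about `R_a` is obtained by subordination: `R_a` is defined as the average of the heat
kernels `G_t` against the weight `t^(a/2-1) / Γ(a/2)`, with values in `[0, ∞]`. The composition
formula (`lintegral_rieszKernel_convolution`) then reduces by Tonelli to the semigroup law of the
Gaussians, i.e. completing a square, and to Euler's beta integral. The pointwise bound
`|g| ≤ R_s * |f|` (`SchwartzMap.enorm_le_lintegral_rieszKernel`) follows from Fourier inversion and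
the self-adjointness of the Fourier transform tested against Gaussians, which needs only the
integrability of the Fourier transform of `f`, not that of `f`.

The Hardy–Rellich inequality is the case `α = 2p`, where the operator is `-Δ` and the Gamma
quotients collapse by `Γ(z + 1) = z Γ(z)`. The case `α = 0` is an equality.
-/

/-! ### The weights `t^(c-1) / Γ(c)` -/

open Set in
lemma lintegral_rpow_mul_exp_neg_mul {c r : ℝ} (hc : 0 < c) (hr : 0 < r) :
    ∫⁻ t in Ioi (0 : ℝ), ENNReal.ofReal (t ^ (c - 1) * Real.exp (-(r * t))) =
      ENNReal.ofReal ((1 / r) ^ c * Real.Gamma c) := by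
  have hpos : 0 < (1 / r) ^ c * Real.Gamma c :=
    mul_pos (Real.rpow_pos_of_pos (by positivity) _) (Real.Gamma_pos_of_pos hc)
  rw [← Real.integral_rpow_mul_exp_neg_mul_Ioi hc hr] at hpos ⊢
  rw [ofReal_integral_eq_lintegral_ofReal (not_imp_comm.1 integral_undef hpos.ne')]
  exact ae_restrict_of_forall_mem measurableSet_Ioi fun t (ht : 0 < t) => by positivity

open Set in
/-- The substitution `t ↦ t⁻¹` on the half-line. -/
lemma lintegral_Ioi_comp_inv (f : ℝ → ENNReal) :
    ∫⁻ t in Ioi (0 : ℝ), f t =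
      ∫⁻ u in Ioi (0 : ℝ), ENNReal.ofReal ((u ^ 2)⁻¹) * f u⁻¹ := by
  have h := lintegral_image_eq_lintegral_abs_deriv_mul (s := Ioi (0 : ℝ)) (f := fun u => u⁻¹)
    (f' := fun u => -(u ^ 2)⁻¹) measurableSet_Ioi
    (fun x (hx : 0 < x) => (hasDerivAt_inv hx.ne').hasDerivWithinAt)
    inv_injective.injOn f
  have himage : (fun u : ℝ => u⁻¹) '' Ioi 0 = Ioi 0 := by
    rw [image_inv_eq_inv]; ext; simp
  rw [himage] at h
  rw [h]
  simp

open Set in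
lemma lintegral_rpow_mul_exp_neg_div {c r : ℝ} (hc : 0 < c) (hr : 0 < r) :
    ∫⁻ t in Ioi (0 : ℝ), ENNReal.ofReal (t ^ (-c - 1) * Real.exp (-(r / t))) =
      ENNReal.ofReal ((1 / r) ^ c * Real.Gamma c) := by
  rw [← lintegral_rpow_mul_exp_neg_mul hc hr, lintegral_Ioi_comp_inv]
  refine setLIntegral_congr_fun measurableSet_Ioi fun t (ht : 0 < t) => ?_
  rw [← ENNReal.ofReal_mul (by positivity)]
  congr 1
  rw [div_inv_eq_mul, ← mul_assoc, Real.inv_rpow ht.le, ← Real.rpow_neg ht.le,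
    ← Real.rpow_natCast, ← Real.rpow_neg ht.le, ← Real.rpow_add ht]
  congr 2
  push_cast
  ring

open Set ProbabilityTheory in
lemma lintegral_Ioo_rpow_mul_rpow {a b r : ℝ} (ha : 0 < a) (hb : 0 < b) (hr : 0 < r) :
    ∫⁻ t in Ioo 0 r, ENNReal.ofReal (t ^ (a - 1) * (r - t) ^ (b - 1)) =
      ENNReal.ofReal (r ^ (a + b - 1) * beta a b) := by
  have h := lintegral_image_eq_lintegral_abs_deriv_mul (s := Ioo (0 : ℝ) 1) (f := fun u => r * u)
    (f' := fun _ => r) measurableSet_Ioo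
    (fun x _ => by simpa using ((hasDerivAt_id x).const_mul r).hasDerivWithinAt)
    (mul_right_injective₀ hr.ne').injOn
    (fun t => ENNReal.ofReal (t ^ (a - 1) * (r - t) ^ (b - 1)))
  rw [image_mul_left_Ioo hr, mul_zero, mul_one] at h
  have hbeta := beta_pos ha hb
  have h1 := lintegral_betaPDF_eq_one ha hb
  rw [lintegral_betaPDF] at h1
  rw [h, ← mul_one (ENNReal.ofReal (r ^ (a + b - 1) * beta a b)), ← h1,
    ← lintegral_const_mul' _ _ ENNReal.ofReal_ne_top]
  refine setLIntegral_congr_fun measurableSet_Ioo fun u ⟨hu0, hu1⟩ => ?_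
  rw [← ENNReal.ofReal_mul (by positivity), ← ENNReal.ofReal_mul (by positivity)]
  congr 1
  rw [abs_of_pos hr, show r - r * u = r * (1 - u) by ring, Real.mul_rpow hr.le hu0.le,
    Real.mul_rpow hr.le (by linarith), show a + b - 1 = 1 + (a - 1) + (b - 1) by ring,
    Real.rpow_add hr, Real.rpow_add hr, Real.rpow_one]
  field_simp

/-- The weight `t^(c-1) / Γ(c)` on the half-line. Integrating `exp (-r t)` against it gives
`r^(-c)`, and the weights form a convolution semigroup in `c`. -/
noncomputable def gammaWeight (c t : ℝ) : ENNReal :=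
  ENNReal.ofReal (t ^ (c - 1) / Real.Gamma c)

@[fun_prop]
lemma measurable_gammaWeight (c : ℝ) : Measurable (gammaWeight c) := by
  unfold gammaWeight; fun_prop

open Set ProbabilityTheory in
lemma lintegral_Ioo_gammaWeight_mul {a b r : ℝ} (ha : 0 < a) (hb : 0 < b) (hr : 0 < r) :
    ∫⁻ t in Ioo 0 r, gammaWeight a t * gammaWeight b (r - t) = gammaWeight (a + b) r := by
  have hga := Real.Gamma_pos_of_pos ha
  have hgb := Real.Gamma_pos_of_pos hb
  have hgab := Real.Gamma_pos_of_pos (add_pos ha hb)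
  calc ∫⁻ t in Ioo 0 r, gammaWeight a t * gammaWeight b (r - t)
      = ∫⁻ t in Ioo 0 r, ENNReal.ofReal ((Real.Gamma a * Real.Gamma b)⁻¹) *
          ENNReal.ofReal (t ^ (a - 1) * (r - t) ^ (b - 1)) := by
        refine setLIntegral_congr_fun measurableSet_Ioo fun t ⟨ht0, ht1⟩ => ?_
        rw [gammaWeight, gammaWeight, ← ENNReal.ofReal_mul (by positivity),
          ← ENNReal.ofReal_mul (by positivity)]
        congr 1
        field_simp
    _ = gammaWeight (a + b) r := by
        rw [lintegral_const_mul' _ _ ENNReal.ofReal_ne_top, lintegral_Ioo_rpow_mul_rpow ha hb hr,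
          ← ENNReal.ofReal_mul (by positivity), gammaWeight]
        congr 1
        rw [beta]
        field_simp

open Set in
/-- Convolution semigroup property of the weights `t^(c-1) / Γ(c)`, in weak form. This is where
Euler's beta integral enters. -/
lemma lintegral_gammaWeight_convolution {a b : ℝ} (ha : 0 < a) (hb : 0 < b) {φ : ℝ → ENNReal}
    (hφ : Measurable φ) :
    ∫⁻ t in Ioi (0 : ℝ), ∫⁻ u in Ioi (0 : ℝ), gammaWeight a t * (gammaWeight b u * φ (t + u)) =
      ∫⁻ r in Ioi (0 : ℝ), gammaWeight (a + b) r * φ r := by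
  have hshift : ∀ t : ℝ, ∫⁻ u in Ioi (0 : ℝ), gammaWeight a t * (gammaWeight b u * φ (t + u)) =
      ∫⁻ r, (Ioi t).indicator (fun r => gammaWeight a t * (gammaWeight b (r - t) * φ r)) r := by
    intro t
    rw [← lintegral_indicator measurableSet_Ioi]
    conv_rhs => rw [← lintegral_add_left_eq_self _ t]
    refine lintegral_congr fun u => ?_
    simp [indicator]
  simp_rw [hshift]
  have hmeas : Measurable (Function.uncurry fun t r : ℝ =>
      (Ioi t).indicator (fun r => gammaWeight a t * (gammaWeight b (r - t) * φ r)) r) := by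
    have : (Function.uncurry fun t r : ℝ =>
        (Ioi t).indicator (fun r => gammaWeight a t * (gammaWeight b (r - t) * φ r)) r) =
        {p : ℝ × ℝ | p.1 < p.2}.indicator
          (fun p => gammaWeight a p.1 * (gammaWeight b (p.2 - p.1) * φ p.2)) := by
      ext ⟨t, r⟩; simp [indicator]
    rw [this]
    exact Measurable.indicator (by fun_prop) (measurableSet_lt measurable_fst measurable_snd)
  rw [lintegral_lintegral_swap hmeas.aemeasurable, ← lintegral_indicator measurableSet_Ioi]
  refine lintegral_congr fun r => ?_
  by_cases hr : 0 < r
  · rw [indicator_of_mem (mem_Ioi.2 hr), ← lintegral_Ioo_gammaWeight_mul ha hb hr,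
      ← lintegral_mul_const _ (by fun_prop), ← lintegral_indicator measurableSet_Ioo,
      ← lintegral_indicator measurableSet_Ioi]
    refine lintegral_congr fun t => ?_
    by_cases h0 : 0 < t <;> by_cases h1 : t < r <;> simp [h0, h1, mul_assoc]
  · rw [indicator_of_notMem (by simpa using hr), ← lintegral_indicator measurableSet_Ioi]
    refine lintegral_eq_zero_of_ae_eq_zero (Filter.Eventually.of_forall fun t => ?_)
    by_cases h0 : 0 < t
    · have : ¬ t < r := by linarith
      simp [this]
    · simp [h0]

/-! ### Heat kernels and Riesz kernels -/

section Kernels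

variable {V : Type*} [NormedAddCommGroup V] [InnerProductSpace ℝ V]

open Module Set

/-- The heat kernel `(4πt)^(-n/2) exp (-‖x‖² / (4t))` on an `n`-dimensional Euclidean space. -/
noncomputable def heatKernel (t : ℝ) (x : V) : ℝ :=
  (4 * Real.pi * t) ^ (-((finrank ℝ V : ℝ) / 2)) * Real.exp (-(‖x‖ ^ 2 / (4 * t)))

lemma heatKernel_nonneg {t : ℝ} (ht : 0 < t) (x : V) : 0 ≤ heatKernel t x := by
  unfold heatKernel; positivity

/-- Completing the square in the product of two Gaussians. -/
lemma norm_sq_div_add_norm_sq_div {t u : ℝ} (ht : 0 < t) (hu : 0 < u) (x y : V) :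
    ‖x - y‖ ^ 2 / (4 * t) + ‖y‖ ^ 2 / (4 * u) =
      (t + u) / (4 * t * u) * ‖y - (u / (t + u)) • x‖ ^ 2 + ‖x‖ ^ 2 / (4 * (t + u)) := by
  have h : 0 < t + u := by positivity
  rw [norm_sub_sq_real, norm_sub_sq_real, inner_smul_right, norm_smul, mul_pow, Real.norm_eq_abs,
    sq_abs, real_inner_comm x y]
  field_simp
  ring

/-- The Riesz kernel of order `a`, written by subordination to the heat kernel:
`Γ(a/2)⁻¹ ∫₀^∞ t^(a/2-1) G_t(x) dt`. It is the kernel of `(-Δ)^(-a/2)`, and takes values in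
`[0, ∞]` so that no convergence question arises. -/
noncomputable def rieszKernel (a : ℝ) (x : V) : ENNReal :=
  ∫⁻ t in Ioi (0 : ℝ), gammaWeight (a / 2) t * ENNReal.ofReal (heatKernel t x)

lemma rieszKernel_sub_comm (a : ℝ) (x y : V) : rieszKernel a (x - y) = rieszKernel a (y - x) := by
  simp only [rieszKernel, heatKernel, norm_sub_rev x y]

/-- The normalising factor of the Riesz kernel of order `a` in dimension `n`. -/
noncomputable def rieszConst (n a : ℝ) : ℝ :=
  Real.pi ^ (-(n / 2)) * 2 ^ (-a) * Real.Gamma ((n - a) / 2) / Real.Gamma (a / 2)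

lemma rieszConst_pos {n a : ℝ} (ha : 0 < a) (han : a < n) : 0 < rieszConst n a := by
  have h1 := Real.Gamma_pos_of_pos (show 0 < (n - a) / 2 by linarith)
  have h2 := Real.Gamma_pos_of_pos (show 0 < a / 2 by linarith)
  unfold rieszConst; positivity

/-- Below the critical order the Riesz kernel is a power of the norm. -/
lemma rieszKernel_eq {a : ℝ} (ha : 0 < a) (han : a < finrank ℝ V) {x : V} (hx : x ≠ 0) :
    rieszKernel a x =
      ENNReal.ofReal (rieszConst (finrank ℝ V) a * ‖x‖ ^ (a - finrank ℝ V)) := by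
  set n : ℝ := (finrank ℝ V : ℝ) with hn
  have hx0 : 0 < ‖x‖ := norm_pos_iff.2 hx
  have hd : 0 < (n - a) / 2 := by linarith
  have hG := Real.Gamma_pos_of_pos (show 0 < a / 2 by linarith)
  have hr : 0 < ‖x‖ ^ 2 / 4 := by positivity
  have hC : 0 ≤ (4 * Real.pi) ^ (-(n / 2)) / Real.Gamma (a / 2) := by positivity
  calc rieszKernel a x
      = ∫⁻ t in Ioi (0 : ℝ), ENNReal.ofReal ((4 * Real.pi) ^ (-(n / 2)) / Real.Gamma (a / 2)) *
          ENNReal.ofReal (t ^ (-((n - a) / 2) - 1) * Real.exp (-(‖x‖ ^ 2 / 4 / t))) := by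
        refine setLIntegral_congr_fun measurableSet_Ioi fun t (ht : 0 < t) => ?_
        rw [gammaWeight, ← ENNReal.ofReal_mul (by positivity), ← ENNReal.ofReal_mul hC, heatKernel,
          ← hn, Real.mul_rpow (by positivity) ht.le,
          show -((n - a) / 2) - 1 = (a / 2 - 1) + -(n / 2) by ring, Real.rpow_add ht, div_div]
        congr 1
        ring
    _ = ENNReal.ofReal (rieszConst n a * ‖x‖ ^ (a - n)) := by
        rw [lintegral_const_mul' _ _ ENNReal.ofReal_ne_top, lintegral_rpow_mul_exp_neg_div hd hr,
          ← ENNReal.ofReal_mul hC, rieszConst]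
        congr 1
        have h1 : (1 / (‖x‖ ^ 2 / 4)) ^ ((n - a) / 2) = 2 ^ (n - a) * ‖x‖ ^ (a - n) := by
          rw [show 1 / (‖x‖ ^ 2 / 4) = (2 * ‖x‖⁻¹) ^ (2 : ℝ) by
              rw [Real.rpow_two]; field_simp; norm_num,
            ← Real.rpow_mul (by positivity), mul_div_cancel₀ _ two_ne_zero,
            Real.mul_rpow (by positivity) (by positivity), Real.inv_rpow hx0.le,
            ← Real.rpow_neg hx0.le, neg_sub]
        have h2 : (4 * Real.pi) ^ (-(n / 2)) = Real.pi ^ (-(n / 2)) * 2 ^ (-n) := by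
          rw [Real.mul_rpow (by positivity) (by positivity), mul_comm,
            show (4 : ℝ) = 2 ^ (2 : ℝ) by norm_num, ← Real.rpow_mul (by positivity)]
          congr 2
          ring
        have h3 : (2 : ℝ) ^ (-a) = 2 ^ (-n) * 2 ^ (n - a) := by
          rw [← Real.rpow_add two_pos]; congr 1; ring
        rw [h1, h2, h3]
        ring

variable [MeasurableSpace V] [BorelSpace V]

lemma measurable_heatKernel : Measurable (Function.uncurry (heatKernel (V := V))) := by
  unfold heatKernel Function.uncurry; fun_prop

lemma measurable_heatKernel_comp {X : Type*} [MeasurableSpace X] {f : X → ℝ} {g : X → V}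
    (hf : Measurable f) (hg : Measurable g) : Measurable fun x => heatKernel (f x) (g x) :=
  measurable_heatKernel.comp (hf.prodMk hg)

@[fun_prop]
lemma measurable_rieszKernel (a : ℝ) : Measurable (rieszKernel (V := V) a) := by
  unfold rieszKernel
  refine Measurable.lintegral_prod_right (f := fun x t => gammaWeight (a / 2) t *
    ENNReal.ofReal (heatKernel t x)) ?_
  exact (by fun_prop : Measurable fun p : V × ℝ => gammaWeight (a / 2) p.2).mul
    (measurable_heatKernel_comp measurable_snd measurable_fst).ennreal_ofReal

variable [FiniteDimensional ℝ V]

lemma lintegral_exp_neg_mul_sq_norm {b : ℝ} (hb : 0 < b) :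
    ∫⁻ v : V, ENNReal.ofReal (Real.exp (-b * ‖v‖ ^ 2)) =
      ENNReal.ofReal ((Real.pi / b) ^ ((finrank ℝ V : ℝ) / 2)) := by
  have hpos : 0 < (Real.pi / b) ^ ((finrank ℝ V : ℝ) / 2) := by positivity
  rw [← GaussianFourier.integral_rexp_neg_mul_sq_norm hb] at hpos ⊢
  rw [ofReal_integral_eq_lintegral_ofReal (not_imp_comm.1 integral_undef hpos.ne')]
  exact Filter.Eventually.of_forall fun v => by positivity

lemma lintegral_heatKernel_convolution {t u : ℝ} (ht : 0 < t) (hu : 0 < u) (x : V) :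
    ∫⁻ y, ENNReal.ofReal (heatKernel t (x - y)) * ENNReal.ofReal (heatKernel u y) =
      ENNReal.ofReal (heatKernel (t + u) x) := by
  have h : 0 < t + u := by positivity
  set N : ℝ := (finrank ℝ V : ℝ) / 2 with hN
  set b : ℝ := (t + u) / (4 * t * u) with hb
  have hb0 : 0 < b := by positivity
  set C : ℝ := (4 * Real.pi * t) ^ (-N) * (4 * Real.pi * u) ^ (-N) *
    Real.exp (-(‖x‖ ^ 2 / (4 * (t + u)))) with hC
  have hC0 : 0 ≤ C := by positivity
  calc ∫⁻ y, ENNReal.ofReal (heatKernel t (x - y)) * ENNReal.ofReal (heatKernel u y)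
      = ∫⁻ y : V, ENNReal.ofReal C *
          ENNReal.ofReal (Real.exp (-b * ‖y - (u / (t + u)) • x‖ ^ 2)) := by
        refine lintegral_congr fun y => ?_
        rw [← ENNReal.ofReal_mul (heatKernel_nonneg ht _), ← ENNReal.ofReal_mul hC0]
        congr 1
        have hexp : Real.exp (-(‖x - y‖ ^ 2 / (4 * t))) * Real.exp (-(‖y‖ ^ 2 / (4 * u))) =
            Real.exp (-(‖x‖ ^ 2 / (4 * (t + u)))) *
              Real.exp (-b * ‖y - (u / (t + u)) • x‖ ^ 2) := by
          rw [← Real.exp_add, ← Real.exp_add]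
          congr 1
          linarith [norm_sq_div_add_norm_sq_div ht hu x y]
        rw [heatKernel, heatKernel, hC, ← hN, mul_mul_mul_comm, hexp]
        ring
    _ = ENNReal.ofReal (heatKernel (t + u) x) := by
        rw [lintegral_const_mul' _ _ ENNReal.ofReal_ne_top,
          lintegral_sub_right_eq_self (fun y : V => ENNReal.ofReal (Real.exp (-b * ‖y‖ ^ 2))),
          lintegral_exp_neg_mul_sq_norm hb0, ← ENNReal.ofReal_mul hC0, hC, heatKernel, ← hN]
        congr 1
        have hsc : (4 * Real.pi * t) ^ (-N) * (4 * Real.pi * u) ^ (-N) * (Real.pi / b) ^ N =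
            (4 * Real.pi * (t + u)) ^ (-N) := by
          rw [Real.rpow_neg (by positivity), Real.rpow_neg (by positivity),
            Real.rpow_neg (by positivity), ← Real.inv_rpow (by positivity),
            ← Real.inv_rpow (by positivity), ← Real.inv_rpow (by positivity),
            ← Real.mul_rpow (by positivity) (by positivity),
            ← Real.mul_rpow (by positivity) (by positivity)]
          congr 1
          rw [hb]
          field_simp
        rw [← hsc]
        ring

/-- Riesz composition formula: the Riesz kernels form a convolution semigroup, because the heat
kernels and the subordinating weights do. The identity holds in `[0, ∞]` without `a + b < n`. -/
lemma lintegral_rieszKernel_convolution {a b : ℝ} (ha : 0 < a) (hb : 0 < b) (x : V) :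
    ∫⁻ y, rieszKernel a (x - y) * rieszKernel b y = rieszKernel (a + b) x := by
  have hm : Measurable fun p : (V × ℝ) × ℝ =>
      gammaWeight (a / 2) p.1.2 * ENNReal.ofReal (heatKernel p.1.2 (x - p.1.1)) *
        (gammaWeight (b / 2) p.2 * ENNReal.ofReal (heatKernel p.2 p.1.1)) := by
    have h1 : Measurable fun p : (V × ℝ) × ℝ => ENNReal.ofReal (heatKernel p.1.2 (x - p.1.1)) :=
      (measurable_heatKernel_comp (by fun_prop) (by fun_prop)).ennreal_ofReal
    have h2 : Measurable fun p : (V × ℝ) × ℝ => ENNReal.ofReal (heatKernel p.2 p.1.1) :=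
      (measurable_heatKernel_comp (by fun_prop) (by fun_prop)).ennreal_ofReal
    fun_prop
  have hm1 (y : V) (a : ℝ) : Measurable fun t => gammaWeight (a / 2) t *
      ENNReal.ofReal (heatKernel t y) := by
    have : Measurable fun t => ENNReal.ofReal (heatKernel t y) :=
      (measurable_heatKernel_comp measurable_id measurable_const).ennreal_ofReal
    fun_prop
  calc ∫⁻ y, rieszKernel a (x - y) * rieszKernel b y
      = ∫⁻ y : V, ∫⁻ t in Ioi (0 : ℝ), ∫⁻ u in Ioi (0 : ℝ),
          gammaWeight (a / 2) t * ENNReal.ofReal (heatKernel t (x - y)) *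
            (gammaWeight (b / 2) u * ENNReal.ofReal (heatKernel u y)) := by
        refine lintegral_congr fun y => ?_
        rw [rieszKernel, rieszKernel, ← lintegral_mul_const _ (hm1 _ a)]
        simp_rw [← lintegral_const_mul _ (hm1 y b)]
    _ = ∫⁻ t in Ioi (0 : ℝ), ∫⁻ y : V, ∫⁻ u in Ioi (0 : ℝ),
          gammaWeight (a / 2) t * ENNReal.ofReal (heatKernel t (x - y)) *
            (gammaWeight (b / 2) u * ENNReal.ofReal (heatKernel u y)) :=
        lintegral_lintegral_swap hm.lintegral_prod_right'.aemeasurable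
    _ = ∫⁻ t in Ioi (0 : ℝ), ∫⁻ u in Ioi (0 : ℝ), ∫⁻ y : V,
          gammaWeight (a / 2) t * ENNReal.ofReal (heatKernel t (x - y)) *
            (gammaWeight (b / 2) u * ENNReal.ofReal (heatKernel u y)) := by
        refine lintegral_congr fun t => lintegral_lintegral_swap ?_
        exact (hm.comp (f := fun p : V × ℝ => ((p.1, t), p.2)) (by fun_prop)).aemeasurable
    _ = ∫⁻ t in Ioi (0 : ℝ), ∫⁻ u in Ioi (0 : ℝ), gammaWeight (a / 2) t *
          (gammaWeight (b / 2) u * ENNReal.ofReal (heatKernel (t + u) x)) := by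
        refine setLIntegral_congr_fun measurableSet_Ioi fun t ht =>
          setLIntegral_congr_fun measurableSet_Ioi fun u hu => ?_
        have hG : Measurable fun y : V => ENNReal.ofReal (heatKernel t (x - y)) *
            ENNReal.ofReal (heatKernel u y) :=
          (measurable_heatKernel_comp (by fun_prop) (by fun_prop)).ennreal_ofReal.mul
            (measurable_heatKernel_comp (by fun_prop) (by fun_prop)).ennreal_ofReal
        rw [← lintegral_heatKernel_convolution ht hu, ← lintegral_const_mul _ hG,
          ← lintegral_const_mul _ (by fun_prop)]
        refine lintegral_congr fun y => ?_
        ring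
    _ = rieszKernel (a + b) x := by
        rw [lintegral_gammaWeight_convolution (half_pos ha) (half_pos hb)
          (φ := fun r => ENNReal.ofReal (heatKernel r x))
          (measurable_heatKernel_comp measurable_id measurable_const).ennreal_ofReal, ← add_div]
        rfl

/-- The Riesz potential of order `a` maps the power `‖y‖^(b-n)` to a multiple of
`‖x‖^(a+b-n)`. -/
lemma lintegral_rieszKernel_mul_norm_rpow {a b : ℝ} (ha : 0 < a) (hb : 0 < b)
    (hab : a + b < finrank ℝ V) {x : V} (hx : x ≠ 0) :
    ∫⁻ y, rieszKernel a (x - y) * ENNReal.ofReal (‖y‖ ^ (b - finrank ℝ V)) =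
      ENNReal.ofReal (rieszConst (finrank ℝ V) (a + b) / rieszConst (finrank ℝ V) b *
        ‖x‖ ^ (a + b - finrank ℝ V)) := by
  have : Nontrivial V := ⟨x, 0, hx⟩
  have hc := rieszConst_pos hb (show b < finrank ℝ V by linarith)
  have hy : ∀ᵐ y : V, y ≠ 0 := by simp [ae_iff]
  calc ∫⁻ y, rieszKernel a (x - y) * ENNReal.ofReal (‖y‖ ^ (b - finrank ℝ V))
      = ∫⁻ y, ENNReal.ofReal (rieszConst (finrank ℝ V) b)⁻¹ *
          (rieszKernel a (x - y) * rieszKernel b y) := by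
        refine lintegral_congr_ae (hy.mono fun y hy => ?_)
        beta_reduce
        rw [rieszKernel_eq hb (by linarith) hy, mul_left_comm,
          ← ENNReal.ofReal_mul (by positivity), inv_mul_cancel_left₀ hc.ne']
    _ = _ := by
        rw [lintegral_const_mul' _ _ ENNReal.ofReal_ne_top,
          lintegral_rieszKernel_convolution ha hb, rieszKernel_eq (by positivity) hab hx,
          ← ENNReal.ofReal_mul (by positivity)]
        congr 1
        ring

end Kernels

/-! ### Schur's test -/

/-- Schur's test: a nonnegative kernel with positive test functions `h`, `k` such that
`∫ K(x,y) h(y)^q dy ≤ C k(x)^q` and `∫ K(x,y) k(x)^p dx ≤ C h(y)^p` is bounded on `L^p` with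
norm at most `C`. -/
lemma lintegral_rpow_lintegral_mul_le_of_schur {X Y : Type*} [MeasurableSpace X]
    [MeasurableSpace Y] {μ : Measure X} {ν : Measure Y} [SFinite μ] [SFinite ν] {p q : ℝ}
    (hpq : p.HolderConjugate q) {K : X → Y → ENNReal} (hK : Measurable (Function.uncurry K))
    {h : Y → ENNReal} (hh : Measurable h) (hh0 : ∀ᵐ y ∂ν, h y ≠ 0) (hhtop : ∀ᵐ y ∂ν, h y ≠ ⊤)
    {k : X → ENNReal} (hk : Measurable k) {C : ENNReal}
    (h1 : ∀ᵐ x ∂μ, ∫⁻ y, K x y * h y ^ q ∂ν ≤ C * k x ^ q)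
    (h2 : ∀ᵐ y ∂ν, ∫⁻ x, K x y * k x ^ p ∂μ ≤ C * h y ^ p)
    {F : Y → ENNReal} (hF : Measurable F) :
    ∫⁻ x, (∫⁻ y, K x y * F y ∂ν) ^ p ∂μ ≤ C ^ p * ∫⁻ y, F y ^ p ∂ν := by
  have hp := hpq.pos
  have hq := hpq.symm.pos
  have hKx (x : X) : Measurable (K x) := hK.comp measurable_prodMk_left
  have hKy (y : Y) : Measurable fun x => K x y := hK.comp measurable_prodMk_right
  have hsum : 1 / q + 1 / p = 1 := by simpa [one_div] using hpq.symm.inv_add_inv_eq_one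
  -- Hölder's inequality, after splitting `K = K^(1/q) K^(1/p)` and inserting `h h⁻¹`
  have hpt : ∀ᵐ x ∂μ, (∫⁻ y, K x y * F y ∂ν) ^ p ≤
      C ^ (p / q) * ∫⁻ y, K x y * k x ^ p * (F y ^ p * (h y)⁻¹ ^ p) ∂ν := by
    filter_upwards [h1] with x hx
    have hsplit : ∫⁻ y, K x y * F y ∂ν =
        ∫⁻ y, ((fun y => K x y ^ (1 / q) * h y) *
          fun y => K x y ^ (1 / p) * (F y * (h y)⁻¹)) y ∂ν := by
      refine lintegral_congr_ae ?_
      filter_upwards [hh0, hhtop] with y hy0 hytop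
      rw [Pi.mul_apply, mul_mul_mul_comm, ← ENNReal.rpow_add_of_nonneg _ _ (by positivity)
        (by positivity), hsum, ENNReal.rpow_one, mul_left_comm (h y),
        ENNReal.mul_inv_cancel hy0 hytop, mul_one]
    have hKF : Measurable fun y => K x y * (F y ^ p * (h y)⁻¹ ^ p) := by
      have := hKx x
      fun_prop
    calc (∫⁻ y, K x y * F y ∂ν) ^ p
        ≤ ((∫⁻ y, K x y * h y ^ q ∂ν) ^ (1 / q) *
            (∫⁻ y, K x y * (F y ^ p * (h y)⁻¹ ^ p) ∂ν) ^ (1 / p)) ^ p := by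
          rw [hsplit]
          gcongr
          refine (ENNReal.lintegral_mul_le_Lp_mul_Lq ν hpq.symm ?_ ?_).trans_eq ?_
          · have := hKx x
            exact Measurable.aemeasurable (by fun_prop)
          · have := hKx x
            exact Measurable.aemeasurable (by fun_prop)
          · congr 2
            · refine lintegral_congr fun y => ?_
              rw [ENNReal.mul_rpow_of_nonneg _ _ hq.le, ← ENNReal.rpow_mul,
                one_div_mul_cancel hq.ne', ENNReal.rpow_one]
            · refine lintegral_congr fun y => ?_
              rw [ENNReal.mul_rpow_of_nonneg _ _ hp.le, ENNReal.mul_rpow_of_nonneg _ _ hp.le,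
                ← ENNReal.rpow_mul, one_div_mul_cancel hp.ne', ENNReal.rpow_one]
      _ ≤ ((C * k x ^ q) ^ (1 / q) *
            (∫⁻ y, K x y * (F y ^ p * (h y)⁻¹ ^ p) ∂ν) ^ (1 / p)) ^ p := by
          gcongr
      _ = C ^ (p / q) * ∫⁻ y, K x y * k x ^ p * (F y ^ p * (h y)⁻¹ ^ p) ∂ν := by
          rw [ENNReal.mul_rpow_of_nonneg _ _ hp.le, ← ENNReal.rpow_mul, ← ENNReal.rpow_mul,
            one_div_mul_cancel hp.ne', ENNReal.rpow_one,
            ENNReal.mul_rpow_of_nonneg _ _ (by positivity), ← ENNReal.rpow_mul,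
            show q * (1 / q * p) = p by field_simp, one_div_mul_eq_div, mul_assoc,
            ← lintegral_const_mul _ hKF]
          congr 1
          refine lintegral_congr fun y => ?_
          ring
  have hm : Measurable (Function.uncurry fun x y =>
      K x y * k x ^ p * (F y ^ p * (h y)⁻¹ ^ p)) := by
    have : Measurable fun z : X × Y => K z.1 z.2 := hK
    unfold Function.uncurry
    fun_prop
  calc ∫⁻ x, (∫⁻ y, K x y * F y ∂ν) ^ p ∂μ
      ≤ ∫⁻ x, C ^ (p / q) * ∫⁻ y, K x y * k x ^ p * (F y ^ p * (h y)⁻¹ ^ p) ∂ν ∂μ :=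
        lintegral_mono_ae hpt
    _ = C ^ (p / q) * ∫⁻ y, ∫⁻ x, K x y * k x ^ p * (F y ^ p * (h y)⁻¹ ^ p) ∂μ ∂ν := by
        rw [lintegral_const_mul _ hm.lintegral_prod_right, lintegral_lintegral_swap
          hm.aemeasurable]
    _ ≤ C ^ (p / q) * ∫⁻ y, C * F y ^ p ∂ν := by
        refine mul_le_mul_right (lintegral_mono_ae ?_) _
        filter_upwards [h2, hh0, hhtop] with y hy hy0 hytop
        have hKk : Measurable fun x => K x y * k x ^ p := by
          have := hKy y
          fun_prop
        rw [lintegral_mul_const _ hKk]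
        calc _ ≤ C * h y ^ p * (F y ^ p * (h y)⁻¹ ^ p) := by gcongr
          _ = C * F y ^ p * (h y * (h y)⁻¹) ^ p := by
              rw [ENNReal.mul_rpow_of_nonneg _ _ hp.le]; ring
          _ = C * F y ^ p := by
              rw [ENNReal.mul_inv_cancel hy0 hytop, ENNReal.one_rpow, mul_one]
    _ = C ^ p * ∫⁻ y, F y ^ p ∂ν := by
        rw [lintegral_const_mul _ (by fun_prop), ← mul_assoc]
        congr 1
        nth_rewrite 2 [← ENNReal.rpow_one C]
        rw [← ENNReal.rpow_add_of_nonneg _ _ (by positivity) zero_le_one]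
        congr 1
        have := hpq.symm.inv_add_inv_eq_one
        field_simp at this ⊢
        linarith

/-! ### Schwartz functions as Riesz potentials -/

section Representation

variable {V : Type*} [NormedAddCommGroup V] [InnerProductSpace ℝ V] [FiniteDimensional ℝ V]
  [MeasurableSpace V] [BorelSpace V]

open Module Set RealInnerProductSpace

/-- The heat semigroup applied to `𝓕⁻ F`, on the Fourier side and as a convolution (with `y`
replaced by `-y`). Only `F` has to be integrable. -/
lemma integral_exp_mul_fourierChar_smul {F : V → ℂ} (hF : Integrable F) {t : ℝ} (ht : 0 < t)
    (x : V) :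
    ∫ ξ, (Real.exp (-((2 * Real.pi * ‖ξ‖) ^ 2 * t)) : ℂ) * (Real.fourierChar ⟪ξ, x⟫ • F ξ) =
      ∫ y, (heatKernel t (y + x) : ℂ) * 𝓕 F y := by
  set b : ℂ := ((1 / (4 * t) : ℝ) : ℂ) with hb
  have hbre : 0 < b.re := by rw [hb, Complex.ofReal_re]; positivity
  set N : ℝ := (finrank ℝ V : ℝ) / 2 with hN
  set c : ℝ := (4 * Real.pi * t) ^ (-N) with hc
  have hγ : Integrable fun v : V => Complex.exp (-b * ‖v‖ ^ 2) := by
    simpa using GaussianFourier.integrable_cexp_neg_mul_sq_norm_add (V := V) hbre 0 0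
  have hshift (ξ : V) : 𝓕 (fun v : V => Complex.exp (-b * ‖v + x‖ ^ 2)) ξ =
      Real.fourierChar ⟪x, ξ⟫ • 𝓕 (fun v : V => Complex.exp (-b * ‖v‖ ^ 2)) ξ :=
    congrFun (VectorFourier.fourierIntegral_comp_add_right Real.fourierChar volume (innerₗ V)
      (fun v : V => Complex.exp (-b * ‖v‖ ^ 2)) x) ξ
  have hflip : ∫ y, 𝓕 F y * Complex.exp (-b * ‖y + x‖ ^ 2) =
      ∫ ξ, F ξ * 𝓕 (fun v : V => Complex.exp (-b * ‖v + x‖ ^ 2)) ξ := by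
    simpa using! (VectorFourier.integral_fourierIntegral_smul_eq_flip (L := innerₗ V)
      Real.continuous_fourierChar continuous_inner hF (hγ.comp_add_right x))
  have hbpi : (Real.pi / b : ℂ) ^ (finrank ℝ V / 2 : ℂ) = ((4 * Real.pi * t) ^ N : ℝ) := by
    rw [Complex.ofReal_cpow (by positivity), hb, hN]
    push_cast
    congr 1
    field_simp
  have hcN : c * (4 * Real.pi * t) ^ N = 1 := by
    rw [hc, ← Real.rpow_add (by positivity), neg_add_cancel, Real.rpow_zero]
  calc ∫ ξ, (Real.exp (-((2 * Real.pi * ‖ξ‖) ^ 2 * t)) : ℂ) * (Real.fourierChar ⟪ξ, x⟫ • F ξ)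
      = ∫ ξ, (c : ℂ) * (F ξ * 𝓕 (fun v : V => Complex.exp (-b * ‖v + x‖ ^ 2)) ξ) := by
        refine integral_congr_ae (Filter.Eventually.of_forall fun ξ => ?_)
        beta_reduce
        rw [hshift, fourier_gaussian_innerProductSpace hbre, hbpi, real_inner_comm]
        have hexp : Complex.exp (-Real.pi ^ 2 * ‖ξ‖ ^ 2 / b) =
            (Real.exp (-((2 * Real.pi * ‖ξ‖) ^ 2 * t)) : ℂ) := by
          rw [Complex.ofReal_exp, hb]
          congr 1
          push_cast
          field_simp
          ring
        rw [hexp, Circle.smul_def, Circle.smul_def, smul_eq_mul, smul_eq_mul]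
        have hcN' : (c : ℂ) * ((4 * Real.pi * t) ^ N : ℝ) = 1 := by
          rw [← Complex.ofReal_mul, hcN, Complex.ofReal_one]
        linear_combination (-(Real.exp (-((2 * Real.pi * ‖ξ‖) ^ 2 * t)) : ℂ) *
          (Real.fourierChar ⟪x, ξ⟫ : ℂ) * F ξ) * hcN'
    _ = ∫ y, (c : ℂ) * (𝓕 F y * Complex.exp (-b * ‖y + x‖ ^ 2)) := by
        rw [integral_const_mul, integral_const_mul, hflip]
    _ = ∫ y, (heatKernel t (y + x) : ℂ) * 𝓕 F y := by
        refine integral_congr_ae (Filter.Eventually.of_forall fun y => ?_)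
        beta_reduce
        rw [heatKernel, ← hN, ← hc, hb]
        push_cast
        rw [show -(1 / (4 * (t : ℂ))) * (‖y + x‖ : ℂ) ^ 2 = -((‖y + x‖ : ℂ) ^ 2 / (4 * t)) by ring]
        ring

lemma enorm_integral_exp_mul_fourierChar_smul_le {F : V → ℂ} (hF : Integrable F) {t : ℝ}
    (ht : 0 < t) (x : V) :
    ‖∫ ξ, (Real.exp (-((2 * Real.pi * ‖ξ‖) ^ 2 * t)) : ℂ) *
        (Real.fourierChar ⟪ξ, x⟫ • F ξ)‖ₑ ≤
      ∫⁻ y, ENNReal.ofReal (heatKernel t (x - y)) * ‖𝓕⁻ F y‖ₑ := by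
  rw [integral_exp_mul_fourierChar_smul hF ht,
    ← integral_neg_eq_self (fun y => (heatKernel t (y + x) : ℂ) * 𝓕 F y)]
  refine (enorm_integral_le_lintegral_enorm _).trans_eq (lintegral_congr fun y => ?_)
  rw [enorm_mul, Real.fourierInv_eq_fourier_neg, neg_add_eq_sub, ← ofReal_norm,
    Complex.norm_real, Real.norm_of_nonneg (heatKernel_nonneg ht _)]

/-- Laplace transform of the Gamma weight. -/
lemma lintegral_gammaWeight_mul_exp {c r : ℝ} (hc : 0 < c) (hr : 0 < r) :
    ∫⁻ t in Ioi (0 : ℝ), gammaWeight c t * ENNReal.ofReal (Real.exp (-(r * t))) =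
      ENNReal.ofReal (r ^ (-c)) := by
  have hG := Real.Gamma_pos_of_pos hc
  calc _ = ∫⁻ t in Ioi (0 : ℝ), ENNReal.ofReal (Real.Gamma c)⁻¹ *
        ENNReal.ofReal (t ^ (c - 1) * Real.exp (-(r * t))) := by
        refine setLIntegral_congr_fun measurableSet_Ioi fun t (ht : 0 < t) => ?_
        rw [gammaWeight, ← ENNReal.ofReal_mul (by positivity),
          ← ENNReal.ofReal_mul (by positivity)]
        congr 1
        ring
    _ = _ := by
        rw [lintegral_const_mul' _ _ ENNReal.ofReal_ne_top, lintegral_rpow_mul_exp_neg_mul hc hr,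
          ← ENNReal.ofReal_mul (by positivity), one_div, Real.inv_rpow hr.le, Real.rpow_neg hr.le]
        congr 1
        field_simp

lemma integral_gammaWeight_mul_exp {c r : ℝ} (hc : 0 < c) (hr : 0 < r) :
    ∫ t in Ioi (0 : ℝ), (gammaWeight c t).toReal * Real.exp (-(r * t)) = r ^ (-c) := by
  rw [integral_eq_lintegral_of_nonneg_ae (Filter.Eventually.of_forall fun t => by positivity)
    (Measurable.aestronglyMeasurable (by fun_prop))]
  rw [← ENNReal.toReal_ofReal (show 0 ≤ r ^ (-c) by positivity),
    ← lintegral_gammaWeight_mul_exp hc hr]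
  congr 1
  refine lintegral_congr fun t => ?_
  rw [ENNReal.ofReal_mul ENNReal.toReal_nonneg, ENNReal.ofReal_toReal]
  exact ENNReal.ofReal_ne_top

lemma SchwartzMap.integrable_rpow_norm_mul (f : 𝓢(V, ℂ)) {s : ℝ} (hs : 0 ≤ s) :
    Integrable fun ξ : V => (((2 * Real.pi * ‖ξ‖) ^ s : ℝ) : ℂ) * f ξ := by
  have h0 := (f.integrable (μ := volume)).norm
  have hk := (f.integrable_pow_mul volume ⌈s⌉₊).const_mul ((2 * Real.pi) ^ ⌈s⌉₊)
  refine (h0.add hk).mono' ?_ (Filter.Eventually.of_forall fun ξ => ?_)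
  · have := f.continuous.measurable
    exact Measurable.aestronglyMeasurable (by fun_prop)
  · rw [norm_mul, Complex.norm_real, Real.norm_of_nonneg (by positivity)]
    have hle : (2 * Real.pi * ‖ξ‖) ^ s ≤ 1 + (2 * Real.pi * ‖ξ‖) ^ ⌈s⌉₊ := by
      rcases le_total (2 * Real.pi * ‖ξ‖) 1 with h | h
      · exact (Real.rpow_le_one (by positivity) h hs).trans (by simp; positivity)
      · rw [← Real.rpow_natCast]
        exact (Real.rpow_le_rpow_of_exponent_le h (Nat.le_ceil s)).trans (by simp)
    calc _ ≤ (1 + (2 * Real.pi * ‖ξ‖) ^ ⌈s⌉₊) * ‖f ξ‖ := by gcongr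
      _ = _ := by simp [mul_pow]; ring

/-- A Schwartz function `g` is pointwise dominated by the Riesz potential of `|(-Δ)^(s/2) g|`.
Fourier inversion and `(2π‖ξ‖)^(-s) = Γ(s/2)⁻¹ ∫₀^∞ t^(s/2-1) exp (-(2π‖ξ‖)² t) dt` write `g` as an
average over `t` of the heat semigroup applied to `(-Δ)^(s/2) g`. -/
lemma SchwartzMap.enorm_le_lintegral_rieszKernel [Nontrivial V] (g : 𝓢(V, ℂ)) {s : ℝ}
    (hs : 0 < s) (x : V) :
    ‖g x‖ₑ ≤ ∫⁻ y, rieszKernel s (x - y) *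
      ‖𝓕⁻ (fun ξ : V => (((2 * Real.pi * ‖ξ‖) ^ s : ℝ) : ℂ) * 𝓕 (g : V → ℂ) ξ) y‖ₑ := by
  set F : V → ℂ := fun ξ => (((2 * Real.pi * ‖ξ‖) ^ s : ℝ) : ℂ) * 𝓕 (g : V → ℂ) ξ with hF
  have hFint : Integrable F := (𝓕 g).integrable_rpow_norm_mul hs.le
  have hFmeas : Measurable F := by
    have : Measurable (𝓕 (g : V → ℂ)) := (𝓕 g).continuous.measurable
    fun_prop
  have hne : ∀ᵐ ξ : V, ξ ≠ 0 := by simp [ae_iff]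
  -- the Laplace transform of the weight at `r = (2π‖ξ‖)²` cancels the symbol `(2π‖ξ‖)^s`
  have hpow {ξ : V} (hξ : ξ ≠ 0) : ((2 * Real.pi * ‖ξ‖) ^ 2) ^ (-(s / 2)) *
      (2 * Real.pi * ‖ξ‖) ^ s = 1 := by
    have h0 : 0 < 2 * Real.pi * ‖ξ‖ := by have := norm_pos_iff.2 hξ; positivity
    rw [← Real.rpow_natCast, ← Real.rpow_mul h0.le, ← Real.rpow_add h0]
    push_cast
    rw [show 2 * -(s / 2) + s = 0 by ring, Real.rpow_zero]
  set w : ℝ → ℝ := fun t => (gammaWeight (s / 2) t).toReal with hw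
  have hwt (t : ℝ) : ENNReal.ofReal (w t) = gammaWeight (s / 2) t :=
    ENNReal.ofReal_toReal ENNReal.ofReal_ne_top
  set H : V → ℝ → ℂ := fun ξ t => ((w t * Real.exp (-((2 * Real.pi * ‖ξ‖) ^ 2 * t)) : ℝ) : ℂ) *
    (Real.fourierChar ⟪ξ, x⟫ • F ξ) with hH
  have hHmeas : Measurable (Function.uncurry H) := by
    have hchar : Measurable fun ξ : V => Real.fourierChar ⟪ξ, x⟫ • F ξ := by
      have : Continuous fun ξ : V => (Real.fourierChar ⟪ξ, x⟫ : ℂ) :=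
        continuous_subtype_val.comp (Real.continuous_fourierChar.comp (by fun_prop))
      exact this.measurable.mul hFmeas
    have : Measurable w := (measurable_gammaWeight _).ennreal_toReal
    simp only [hH, Function.uncurry_def]
    exact Measurable.mul (by fun_prop) (hchar.comp measurable_fst)
  have hHnorm (ξ : V) (t : ℝ) : ‖H ξ t‖ₑ = gammaWeight (s / 2) t *
      ENNReal.ofReal (Real.exp (-((2 * Real.pi * ‖ξ‖) ^ 2 * t))) * ‖F ξ‖ₑ := by
    have hw0 : 0 ≤ w t := ENNReal.toReal_nonneg
    rw [← hwt, ← ENNReal.ofReal_mul hw0, ← ofReal_norm, ← ofReal_norm,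
      ← ENNReal.ofReal_mul (by positivity), norm_mul, Circle.norm_smul, Complex.norm_real,
      Real.norm_of_nonneg (by positivity)]
  have hHint : Integrable (Function.uncurry H)
      ((volume : Measure V).prod (volume.restrict (Ioi (0 : ℝ)))) := by
    refine ⟨hHmeas.aestronglyMeasurable, ?_⟩
    rw [hasFiniteIntegral_iff_enorm, lintegral_prod _ hHmeas.enorm.aemeasurable]
    have hg : ∫⁻ ξ : V, ‖𝓕 (g : V → ℂ) ξ‖ₑ < ⊤ := (𝓕 g).integrable.2
    refine lt_of_eq_of_lt (lintegral_congr_ae (hne.mono fun ξ hξ => ?_)) hg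
    have hr : 0 < (2 * Real.pi * ‖ξ‖) ^ 2 := by have := norm_pos_iff.2 hξ; positivity
    simp only [Function.uncurry_apply_pair, hHnorm]
    rw [lintegral_mul_const _ (by fun_prop), lintegral_gammaWeight_mul_exp (half_pos hs) hr,
      ← ofReal_norm, ← ofReal_norm, ← ENNReal.ofReal_mul (by positivity), hF,
      norm_mul, Complex.norm_real, Real.norm_of_nonneg (by positivity), ← mul_assoc, hpow hξ,
      one_mul]
  have hgx : g x = ∫ t in Ioi (0 : ℝ), ∫ ξ, H ξ t := by
    rw [← integral_integral_swap hHint]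
    have hinv : 𝓕⁻ (𝓕 (g : V → ℂ)) x = g x :=
      congrFun (g.continuous.fourierInv_fourier_eq g.integrable (𝓕 g).integrable) x
    rw [← hinv, Real.fourierInv_eq]
    refine integral_congr_ae (hne.mono fun ξ hξ => ?_)
    have hr : 0 < (2 * Real.pi * ‖ξ‖) ^ 2 := by have := norm_pos_iff.2 hξ; positivity
    simp only [hH]
    rw [integral_mul_const, integral_complex_ofReal, hw,
      integral_gammaWeight_mul_exp (half_pos hs) hr, Circle.smul_def, Circle.smul_def, hF]
    simp only [smul_eq_mul]
    have := congrArg (fun r : ℝ => (r : ℂ)) (hpow hξ)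
    push_cast at this ⊢
    linear_combination (-(Real.fourierChar ⟪ξ, x⟫ : ℂ) * 𝓕 (g : V → ℂ) ξ) * this
  have hfmeas : Measurable fun y => ‖𝓕⁻ F y‖ₑ := by
    have : Continuous (𝓕⁻ F) := by
      simp_rw [funext (Real.fourierInv_eq_fourier_neg F)]
      exact (VectorFourier.fourierIntegral_continuous Real.continuous_fourierChar
        (L := innerₗ V) continuous_inner hFint).comp continuous_neg
    exact this.measurable.enorm
  have hswap : Measurable (Function.uncurry fun (t : ℝ) (y : V) => gammaWeight (s / 2) t *
      (ENNReal.ofReal (heatKernel t (x - y)) * ‖𝓕⁻ F y‖ₑ)) := by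
    have h1 : Measurable fun p : ℝ × V => ENNReal.ofReal (heatKernel p.1 (x - p.2)) :=
      (measurable_heatKernel_comp (by fun_prop) (by fun_prop)).ennreal_ofReal
    have h2 : Measurable fun p : ℝ × V => ‖𝓕⁻ F p.2‖ₑ := hfmeas.comp measurable_snd
    unfold Function.uncurry
    fun_prop
  calc ‖g x‖ₑ ≤ ∫⁻ t in Ioi (0 : ℝ), ‖∫ ξ, H ξ t‖ₑ := by
        rw [hgx]; exact enorm_integral_le_lintegral_enorm _
    _ ≤ ∫⁻ t in Ioi (0 : ℝ), ∫⁻ y, gammaWeight (s / 2) t *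
          (ENNReal.ofReal (heatKernel t (x - y)) * ‖𝓕⁻ F y‖ₑ) := by
        refine setLIntegral_mono' measurableSet_Ioi fun t ht => ?_
        have hG : Measurable fun y : V => ENNReal.ofReal (heatKernel t (x - y)) * ‖𝓕⁻ F y‖ₑ :=
          (measurable_heatKernel_comp (by fun_prop) (by fun_prop)).ennreal_ofReal.mul hfmeas
        rw [lintegral_const_mul _ hG]
        simp only [hH, Complex.ofReal_mul, mul_assoc]
        simp only [← mul_assoc (2 : ℝ)]
        rw [integral_const_mul, enorm_mul, ← ofReal_norm (w t : ℂ), Complex.norm_real,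
          Real.norm_of_nonneg ENNReal.toReal_nonneg, hwt]
        gcongr
        exact enorm_integral_exp_mul_fourierChar_smul_le hFint ht x
    _ = ∫⁻ y, rieszKernel s (x - y) * ‖𝓕⁻ F y‖ₑ := by
        rw [lintegral_lintegral_swap hswap.aemeasurable]
        refine lintegral_congr fun y => ?_
        have hG : Measurable fun t : ℝ => ENNReal.ofReal (heatKernel t (x - y)) :=
          (measurable_heatKernel_comp (by fun_prop) (by fun_prop)).ennreal_ofReal
        simp_rw [← mul_assoc]
        rw [lintegral_mul_const _ (by fun_prop)]
        rfl

end Representation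

/-! ### Sharp weighted inequalities -/

section Inequality

variable {V : Type*} [NormedAddCommGroup V] [InnerProductSpace ℝ V] [FiniteDimensional ℝ V]
  [MeasurableSpace V] [BorelSpace V]

open Module

/-- The Stein–Weiss inequality, with its sharp constant, for the operator
`F ↦ ‖x‖^(-s) (R_s * F)(x)`. Schur's test is applied with the power `‖x‖^(-n/(pq))`. -/
lemma lintegral_rieszKernel_rpow_le {p q s : ℝ} (hpq : p.HolderConjugate q) (hs : 0 < s)
    (hsn : s < finrank ℝ V / p) {F : V → ENNReal} (hF : Measurable F) :
    ∫⁻ x, (∫⁻ y, ENNReal.ofReal (‖x‖ ^ (-s)) * rieszKernel s (x - y) * F y) ^ p ≤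
      ENNReal.ofReal (rieszConst (finrank ℝ V) (s + finrank ℝ V / q) /
        rieszConst (finrank ℝ V) (finrank ℝ V / q)) ^ p * ∫⁻ y, F y ^ p := by
  have hp := hpq.pos
  have hq := hpq.symm.pos
  set n : ℝ := (finrank ℝ V : ℝ) with hn
  have hn0 : 0 < n := by
    by_contra h
    have : n / p ≤ 0 := div_nonpos_of_nonpos_of_nonneg (by linarith) hp.le
    linarith
  have : Nontrivial V := finrank_pos_iff (R := ℝ).1 (Nat.cast_pos.1 (hn ▸ hn0 : (0 : ℝ) < _))
  have hne : ∀ᵐ x : V, x ≠ 0 := by simp [ae_iff]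
  have hpq' : n / p + n / q = n := by
    have := hpq.inv_add_inv_eq_one
    rw [div_eq_mul_inv, div_eq_mul_inv, ← mul_add, this, mul_one]
  have hnp : 0 < n / p := by positivity
  have hnq : 0 < n / q := by positivity
  -- the two Schur conditions are instances of the composition formula with `b = n/q` and
  -- `b = n/p - s`, and they have the same constant
  have hconst : rieszConst n (s + (n / p - s)) / rieszConst n (n / p - s) =
      rieszConst n (s + n / q) / rieszConst n (n / q) := by
    have h1 := Real.Gamma_pos_of_pos (show 0 < (n / p - s) / 2 by linarith)
    have h2 := Real.Gamma_pos_of_pos (show 0 < (n / p) / 2 by linarith)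
    have h3 := Real.Gamma_pos_of_pos (show 0 < (n / q) / 2 by linarith)
    have h4 := Real.Gamma_pos_of_pos (show 0 < (s + n / q) / 2 by linarith)
    have h5 : (2 : ℝ) ^ (-(s + (n / p - s))) = 2 ^ (-s) * 2 ^ (-(n / p - s)) := by
      rw [← Real.rpow_add two_pos]; congr 1; ring
    have h6 : (2 : ℝ) ^ (-(s + n / q)) = 2 ^ (-s) * 2 ^ (-(n / q)) := by
      rw [← Real.rpow_add two_pos]; congr 1; ring
    unfold rieszConst
    rw [h5, h6, show n - (s + (n / p - s)) = n / q by linarith,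
      show n - (n / p - s) = s + n / q by linarith,
      show n - (s + n / q) = n / p - s by linarith, show n - n / q = n / p by linarith,
      show s + (n / p - s) = n / p by ring]
    field_simp
  set C := rieszConst n (s + n / q) / rieszConst n (n / q) with hC
  have hC0 : 0 ≤ C := (div_pos (rieszConst_pos (by positivity) (by linarith))
    (rieszConst_pos hnq (by linarith))).le
  have hrpow {x : V} (hx : x ≠ 0) {r m : ℝ} (hr : 0 ≤ r) (hm : -(n / (p * q)) * r = m) :
      ENNReal.ofReal (‖x‖ ^ (-(n / (p * q)))) ^ r = ENNReal.ofReal (‖x‖ ^ m) := by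
    rw [ENNReal.ofReal_rpow_of_nonneg (by positivity) hr, ← Real.rpow_mul (norm_nonneg _), hm]
  have hq_exp : -(n / (p * q)) * q = n / q - n := by
    rw [show -(n / (p * q)) * q = -(n / p) by field_simp]; linarith
  have hp_exp : -(n / (p * q)) * p = n / p - n := by
    rw [show -(n / (p * q)) * p = -(n / q) by field_simp]; linarith
  refine lintegral_rpow_lintegral_mul_le_of_schur hpq
    (K := fun x y : V => ENNReal.ofReal (‖x‖ ^ (-s)) * rieszKernel s (x - y))
    (h := fun y => ENNReal.ofReal (‖y‖ ^ (-(n / (p * q)))))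
    (k := fun y => ENNReal.ofReal (‖y‖ ^ (-(n / (p * q))))) ?_ (by fun_prop) ?_
    (Filter.Eventually.of_forall fun y => ENNReal.ofReal_ne_top) (by fun_prop) ?_ ?_ hF
  · unfold Function.uncurry
    fun_prop
  · filter_upwards [hne] with y hy
    have := norm_pos_iff.2 hy
    exact (ENNReal.ofReal_pos.2 (by positivity)).ne'
  · filter_upwards [hne] with x hx
    have hx0 := norm_pos_iff.2 hx
    calc _ = ∫⁻ y, ENNReal.ofReal (‖x‖ ^ (-s)) *
          (rieszKernel s (x - y) * ENNReal.ofReal (‖y‖ ^ (n / q - n))) := by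
          refine lintegral_congr_ae (hne.mono fun y hy => ?_)
          beta_reduce
          rw [hrpow hy hq.le hq_exp, mul_assoc]
      _ = ENNReal.ofReal C * ENNReal.ofReal (‖x‖ ^ (n / q - n)) := by
          rw [lintegral_const_mul' _ _ ENNReal.ofReal_ne_top,
            lintegral_rieszKernel_mul_norm_rpow hs hnq (by linarith) hx,
            ← ENNReal.ofReal_mul (by positivity), ← ENNReal.ofReal_mul hC0, ← hn, ← hC,
            mul_left_comm, ← Real.rpow_add hx0]
          congr 3
          ring
      _ ≤ _ := by rw [hrpow hx hq.le hq_exp]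
  · filter_upwards [hne] with y hy
    calc _ = ∫⁻ x, rieszKernel s (y - x) * ENNReal.ofReal (‖x‖ ^ ((n / p - s) - n)) := by
          refine lintegral_congr_ae (hne.mono fun x hx => ?_)
          beta_reduce
          rw [hrpow hx hp.le hp_exp, rieszKernel_sub_comm, mul_right_comm,
            ← ENNReal.ofReal_mul (by positivity), ← Real.rpow_add (norm_pos_iff.2 hx), mul_comm]
          congr 3
          ring
      _ = ENNReal.ofReal C * ENNReal.ofReal (‖y‖ ^ (n / p - n)) := by
          rw [lintegral_rieszKernel_mul_norm_rpow hs (by linarith) (by linarith) hy,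
            ← ENNReal.ofReal_mul hC0, ← hn, hconst]
          congr 3
          ring
      _ ≤ _ := by rw [hrpow hy hp.le hp_exp]

end Inequality

lemma pittConst_eq_rieszConst_div {n : ℕ} {p q α : ℝ} (hpq : p.HolderConjugate q) (hα : 0 ≤ α)
    (hαn : α < n) :
    pittConst n p q α = rieszConst n (α / p + n / q) / rieszConst n (n / q) := by
  have hp := hpq.pos
  have hq := hpq.symm.pos
  have hn0 : (0 : ℝ) < n := by linarith
  have hpq' : (n : ℝ) / p + n / q = n := by
    rw [div_eq_mul_inv, div_eq_mul_inv, ← mul_add, hpq.inv_add_inv_eq_one, mul_one]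
  have h1 := Real.Gamma_pos_of_pos (show 0 < ((n : ℝ) - α) / (2 * p) by
    have : 0 < (n : ℝ) - α := by linarith
    positivity)
  have h2 := Real.Gamma_pos_of_pos (show 0 < (n : ℝ) / (2 * p) by positivity)
  have h3 := Real.Gamma_pos_of_pos (show 0 < (n : ℝ) / (2 * q) by positivity)
  have h4 := Real.Gamma_pos_of_pos (show 0 < (n : ℝ) / (2 * q) + α / (2 * p) by positivity)
  unfold pittConst rieszConst
  rw [show ((n : ℝ) - (α / p + n / q)) / 2 = (n - α) / (2 * p) by
      rw [show (n : ℝ) - (α / p + n / q) = n / p - α / p by linarith]; field_simp,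
    show ((n : ℝ) - n / q) / 2 = n / (2 * p) by
      rw [show (n : ℝ) - n / q = n / p by linarith]; field_simp,
    show (α / p + (n : ℝ) / q) / 2 = n / (2 * q) + α / (2 * p) by field_simp; ring,
    show ((n : ℝ) / q) / 2 = n / (2 * q) by field_simp,
    neg_add, Real.rpow_add two_pos]
  field_simp

lemma continuous_fracLaplacian {n : ℕ} {s : ℝ} (hs : 0 ≤ s) (g : 𝓢(EuclideanSpace ℝ (Fin n), ℂ)) :
    Continuous (fracLaplacian s g) := by
  unfold fracLaplacian
  simp_rw [funext (Real.fourierInv_eq_fourier_neg _)]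
  exact (VectorFourier.fourierIntegral_continuous Real.continuous_fourierChar
    (L := innerₗ (EuclideanSpace ℝ (Fin n))) continuous_inner
    ((𝓕 g).integrable_rpow_norm_mul hs)).comp continuous_neg

/-- Pitt's inequality for `α > 0`, for the `p`-th powers of the norms. -/
lemma lintegral_rpow_enorm_le_pittConst {n : ℕ} {p q α : ℝ} (hpq : p.HolderConjugate q)
    (hα : 0 < α) (hαn : α < n) (g : 𝓢(EuclideanSpace ℝ (Fin n), ℂ)) :
    ∫⁻ x : EuclideanSpace ℝ (Fin n), ‖((‖x‖ ^ (-(α / p)) : ℝ) : ℂ) * g x‖ₑ ^ p ≤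
      ENNReal.ofReal (pittConst n p q α) ^ p * ∫⁻ x, ‖fracLaplacian (α / p) g x‖ₑ ^ p := by
  have hp := hpq.pos
  have hs : 0 < α / p := div_pos hα hp
  have hfin : ((Module.finrank ℝ (EuclideanSpace ℝ (Fin n)) : ℕ) : ℝ) = n := by simp
  have : Nontrivial (EuclideanSpace ℝ (Fin n)) := by
    refine Module.finrank_pos_iff (R := ℝ).1 ?_
    have : (0 : ℝ) < n := by linarith
    rw [finrank_euclideanSpace_fin]
    exact_mod_cast this
  have hSW := lintegral_rieszKernel_rpow_le (V := EuclideanSpace ℝ (Fin n)) hpq hs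
    (by rw [hfin]; gcongr) (continuous_fracLaplacian hs.le g).enorm.measurable
  rw [hfin, ← pittConst_eq_rieszConst_div hpq hα.le hαn] at hSW
  refine le_trans (lintegral_mono fun x => ?_) hSW
  beta_reduce
  gcongr
  rw [enorm_mul, ← ofReal_norm, Complex.norm_real, Real.norm_of_nonneg (by positivity)]
  simp_rw [mul_assoc]
  rw [lintegral_const_mul' _ _ ENNReal.ofReal_ne_top]
  gcongr
  exact g.enorm_le_lintegral_rieszKernel hs x

lemma fracLaplacian_zero {n : ℕ} (g : 𝓢(EuclideanSpace ℝ (Fin n), ℂ)) :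
    fracLaplacian 0 g = g := by
  simp only [fracLaplacian, Real.rpow_zero, Complex.ofReal_one, one_mul]
  exact g.continuous.fourierInv_fourier_eq g.integrable (𝓕 g).integrable

lemma fracLaplacian_two {n : ℕ} (g : 𝓢(EuclideanSpace ℝ (Fin n), ℂ))
    (x : EuclideanSpace ℝ (Fin n)) :
    fracLaplacian 2 g x = -Δ (g : EuclideanSpace ℝ (Fin n) → ℂ) x := by
  have hgrowth : (fun ξ : EuclideanSpace ℝ (Fin n) => ‖ξ‖ ^ 2).HasTemperateGrowth := by
    fun_prop
  rw [← SchwartzMap.laplacian_apply, SchwartzMap.laplacian_eq_fourierMultiplierCLM,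
    SchwartzMap.fourierMultiplierCLM_apply]
  simp only [smul_apply, SchwartzMap.fourierInv_coe, fracLaplacian]
  rw [Real.fourierInv_eq, Real.fourierInv_eq, neg_smul, neg_neg, ← integral_smul]
  refine integral_congr_ae (Filter.Eventually.of_forall fun ξ => ?_)
  beta_reduce
  rw [SchwartzMap.smulLeftCLM_apply_apply hgrowth, SchwartzMap.fourier_coe, Real.rpow_two,
    smul_comm]
  congr 1
  rw [smul_smul, Complex.real_smul]
  push_cast
  ring

lemma pittConst_zero {n : ℕ} {p q : ℝ} (hpq : p.HolderConjugate q) (hn : 0 < n) :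
    pittConst n p q 0 = 1 := by
  have hn0 : (0 : ℝ) < n := by exact_mod_cast hn
  have hp := hpq.pos
  have hq := hpq.symm.pos
  have h2 := Real.Gamma_pos_of_pos (show 0 < (n : ℝ) / (2 * p) by positivity)
  have h3 := Real.Gamma_pos_of_pos (show 0 < (n : ℝ) / (2 * q) by positivity)
  simp only [pittConst, zero_div, neg_zero, Real.rpow_zero, sub_zero, add_zero, one_mul]
  rw [mul_comm, div_self (by positivity)]

lemma pittConst_two_mul {n : ℕ} {p q : ℝ} (hpq : p.HolderConjugate q) (hpn : 2 * p < n) :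
    pittConst n p q (2 * p) = p * q / (n * (n - 2 * p)) := by
  have hp := hpq.pos
  have hq := hpq.symm.pos
  have hn0 : (0 : ℝ) < n := by linarith
  have hd : 0 < (n : ℝ) - 2 * p := by linarith
  have hu : 0 < ((n : ℝ) - 2 * p) / (2 * p) := by positivity
  have hv : 0 < (n : ℝ) / (2 * q) := by positivity
  have h1 := Real.Gamma_pos_of_pos hu
  have h3 := Real.Gamma_pos_of_pos hv
  have hG1 : Real.Gamma ((n : ℝ) / (2 * p)) =
      ((n : ℝ) - 2 * p) / (2 * p) * Real.Gamma (((n : ℝ) - 2 * p) / (2 * p)) := by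
    rw [← Real.Gamma_add_one hu.ne']; congr 1; field_simp; ring
  have hG2 : Real.Gamma ((n : ℝ) / (2 * q) + 2 * p / (2 * p)) =
      (n : ℝ) / (2 * q) * Real.Gamma ((n : ℝ) / (2 * q)) := by
    rw [← Real.Gamma_add_one hv.ne', div_self (by positivity)]
  have h4 : (2 : ℝ) ^ (-(2 * p / p)) = 1 / 4 := by
    rw [mul_div_cancel_right₀ _ hp.ne', Real.rpow_neg two_pos.le, Real.rpow_two]; norm_num
  rw [pittConst, hG1, hG2, h4]
  field_simp
  norm_num

theorem corollary1 (n : ℕ) (p q : ℝ) (hpq : p.HolderConjugate q)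
    (g : 𝓢(EuclideanSpace ℝ (Fin n), ℂ)) :
    (∀ α : ℝ, 0 ≤ α → α < (n : ℝ) →
      eLpNorm (fun x : EuclideanSpace ℝ (Fin n) => ((‖x‖ ^ (-(α / p)) : ℝ) : ℂ) * g x)
          (ENNReal.ofReal p) volume ≤
        ENNReal.ofReal (pittConst n p q α) *
          eLpNorm (fracLaplacian (α / p) g) (ENNReal.ofReal p) volume) ∧
    (p < (n : ℝ) / 2 →
      ∫⁻ x : EuclideanSpace ℝ (Fin n), ENNReal.ofReal (‖x‖ ^ (-(2 * p)) * ‖g x‖ ^ p) ≤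
        ENNReal.ofReal ((p * q / ((n : ℝ) * ((n : ℝ) - 2 * p))) ^ p) *
          ∫⁻ x : EuclideanSpace ℝ (Fin n),
            ENNReal.ofReal (‖Δ (g : EuclideanSpace ℝ (Fin n) → ℂ) x‖ ^ p)) := by
  have hp := hpq.pos
  have hq := hpq.symm.pos
  refine ⟨fun α hα hαn => ?_, fun hpn => ?_⟩
  · rcases hα.eq_or_lt with rfl | hα
    · rw [pittConst_zero hpq (by exact_mod_cast hαn)]
      simp [fracLaplacian_zero]
    · have hp0 : ENNReal.ofReal p ≠ 0 := (ENNReal.ofReal_pos.2 hp).ne'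
      rw [eLpNorm_eq_lintegral_rpow_enorm_toReal hp0 ENNReal.ofReal_ne_top,
        eLpNorm_eq_lintegral_rpow_enorm_toReal hp0 ENNReal.ofReal_ne_top,
        ENNReal.toReal_ofReal hp.le]
      calc _ ≤ (ENNReal.ofReal (pittConst n p q α) ^ p *
            ∫⁻ x, ‖fracLaplacian (α / p) g x‖ₑ ^ p) ^ (1 / p) := by
            gcongr
            exact lintegral_rpow_enorm_le_pittConst hpq hα hαn g
        _ = _ := by
            rw [ENNReal.mul_rpow_of_nonneg _ _ (by positivity), ← ENNReal.rpow_mul,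
              mul_one_div_cancel hp.ne', ENNReal.rpow_one]
  · have hpn' : 2 * p < n := by linarith
    have hc : 0 ≤ p * q / ((n : ℝ) * ((n : ℝ) - 2 * p)) := by
      have : 0 ≤ (n : ℝ) - 2 * p := by linarith
      positivity
    have h := lintegral_rpow_enorm_le_pittConst hpq (by positivity) hpn' g
    rw [mul_div_cancel_right₀ _ hp.ne', pittConst_two_mul hpq hpn',
      ENNReal.ofReal_rpow_of_nonneg hc hp.le] at h
    refine le_of_eq_of_le (lintegral_congr fun x => ?_)
      (h.trans_eq (congrArg _ (lintegral_congr fun x => ?_)))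
    · rw [← ofReal_norm, ENNReal.ofReal_rpow_of_nonneg (norm_nonneg _) hp.le, norm_mul,
        Complex.norm_real, Real.norm_of_nonneg (by positivity),
        Real.mul_rpow (by positivity) (norm_nonneg _), ← Real.rpow_mul (norm_nonneg _), neg_mul]
    · rw [fracLaplacian_two, enorm_neg, ← ofReal_norm,
        ENNReal.ofReal_rpow_of_nonneg (norm_nonneg _) hp.le]
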